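/- A \emph{weight} on $\mathbb R$ is a Borel measurable map $\omega:\mathbb R\to[1,\infty)$ with $\omega(x+y)\le\omega(x)\omega(y)$ for all $x,y\in\mathbb R$. Put $\rho_{1,\omega}=\sup\{\frac{\log\omega(x)}{x}:x<0\}$ and $\rho_{2,\omega}=\inf\{\frac{\log\omega(x)}{x}:x>0\}$; the weight $\omega$ is \emph{admissible} if $\rho_{1,\omega}=0=\rho_{2,\omega}$. For a unital complex Banach algebra $\mathcal A$ with unit $\mathbf e$, let $L^1(\mathbb R,\omega,\mathcal A)$ be the algebra of (a.e. classes of) strongly measurable $f:\mathbb R\to\mathcal A$ with $\int_{\mathbb R}\|f(x)\|\,\omega(x)\,dx<\infty$, with the convolution product $(f\star g)(x)=\int_{\mathbb R}f(x-t)g(t)\,dt$, and let $L^1(\mathbb R,\omega,\mathcal A)_{\mathbf 1}=\mathbb C\mathbf 1\oplus L^1(\mathbb R,\omega,\mathcal A)$ be the unitization obtained by adjoining a unit $\mathbf 1$. If $\nu\le\omega$ are weights, then $L^1(\mathbb R,\omega,\mathcal A)\subset L^1(\mathbb R,\nu,\mathcal A)$. Theorem. Let $\mathcal A$ be a unital complex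 Banach algebra with unit $\mathbf e$, let $\omega$ be a weight on $\mathbb R$, and let $f\in L^1(\mathbb R,\omega,\mathcal A)$ be such that $\mathbf e+\int_{\mathbb R}f(x)e^{itx}\,dx$ is left invertible (respectively, right invertible, invertible) in $\mathcal A$ for all $t\in\mathbb R$. Then there are a weight $\nu$ on $\mathbb R$ and $g\in L^1(\mathbb R,\nu,\mathcal A)$ such that $1\le\nu\le\omega$, $\nu$ is constant if and only if $\omega$ is constant, and $\mathbf 1+g$ is a left inverse (respectively, right inverse, inverse) of $\mathbf 1+f$ in $L^1(\mathbb R,\nu,\mathcal A)_{\mathbf 1}$. In particular, if $\omega$ is admissible, then $\mathbf 1+f$ is left invertible (respectively, right invertible, invertible) in $L^1(\mathbb R,\omega,\mathcal A)_{\mathbf 1}$. -/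

import Mathlib

open MeasureTheory
open scoped Convolution

/-- A weight on the real line: a Borel measurable map `ω : ℝ → [1, ∞)` which is submultiplicative
with respect to addition on `ℝ`. -/
structure BeurlingWeight where
  toFun : ℝ → ℝ
  measurable' : Measurable toFun
  one_le' : ∀ x, 1 ≤ toFun x
  map_add_le_mul' : ∀ x y, toFun (x + y) ≤ toFun x * toFun y

namespace BeurlingWeight

instance : CoeFun BeurlingWeight (fun _ => ℝ → ℝ) := ⟨toFun⟩

/-- `sup {log (ω(x) ^ (1/x)) : x < 0}`, with `log (ω(x) ^ (1/x)) = log ω(x) / x`.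
The set is bounded above by `0`. -/
noncomputable def rho₁ (ω : BeurlingWeight) : ℝ :=
  sSup ((fun x : ℝ => Real.log (ω x) / x) '' Set.Iio 0)

/-- `inf {log (ω(x) ^ (1/x)) : x > 0}`, with `log (ω(x) ^ (1/x)) = log ω(x) / x`.
The set is bounded below by `0`. -/
noncomputable def rho₂ (ω : BeurlingWeight) : ℝ :=
  sInf ((fun x : ℝ => Real.log (ω x) / x) '' Set.Ioi 0)

/-- A weight is admissible if both of its growth exponents vanish. -/
def IsAdmissible (ω : BeurlingWeight) : Prop := ω.rho₁ = 0 ∧ ω.rho₂ = 0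

/-- The weight is a constant function. -/
def IsConstant (ω : BeurlingWeight) : Prop := ∃ c : ℝ, ∀ x, ω x = c

end BeurlingWeight

/-- The linear space of (a.e. classes of) strongly measurable `f : ℝ → 𝒜` such that
`∫ ‖f(x)‖ ω(x) dx < ∞`. -/
def beurlingSubmodule (ω : BeurlingWeight) (𝒜 : Type*) [NormedRing 𝒜] [NormedAlgebra ℂ 𝒜] :
    Submodule ℂ (ℝ →ₘ[volume] 𝒜) where
  carrier := {f | Integrable (fun x => ‖f x‖ * ω x) volume}
  zero_mem' := by
    refine (integrable_zero ℝ ℝ volume).congr ?_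
    filter_upwards [AEEqFun.coeFn_zero (α := ℝ) (β := 𝒜) (μ := volume)] with x hx
    simp [hx]
  add_mem' := by
    intro f g hf hg
    refine (Integrable.add hf hg).mono'
      ((f + g).aestronglyMeasurable.norm.mul ω.measurable'.aestronglyMeasurable) ?_
    filter_upwards [AEEqFun.coeFn_add f g] with x hx
    have h := zero_le_one.trans (ω.one_le' x)
    rw [hx, Real.norm_of_nonneg (mul_nonneg (norm_nonneg _) h)]
    simpa [add_mul] using mul_le_mul_of_nonneg_right (norm_add_le (f x) (g x)) h
  smul_mem' := by
    intro c f hf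
    refine (Integrable.const_mul hf ‖c‖).congr ?_
    filter_upwards [AEEqFun.coeFn_smul c f] with x hx
    rw [hx, Pi.smul_apply, norm_smul, mul_assoc]

/-- The weighted space `L¹(ℝ, ω, 𝒜)`. -/
abbrev BeurlingL1 (ω : BeurlingWeight) (𝒜 : Type*) [NormedRing 𝒜] [NormedAlgebra ℂ 𝒜] : Type _ :=
  beurlingSubmodule ω 𝒜

namespace BeurlingL1

variable {ω ν : BeurlingWeight} {𝒜 : Type*} [NormedRing 𝒜] [NormedAlgebra ℂ 𝒜]

theorem integrable_norm_mul (f : BeurlingL1 ω 𝒜) :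
    Integrable (fun x => ‖f.1 x‖ * ω x) volume := f.2

theorem integrable (f : BeurlingL1 ω 𝒜) : Integrable (f.1 : ℝ → 𝒜) volume := by
  refine f.integrable_norm_mul.mono' f.1.aestronglyMeasurable (.of_forall fun x => ?_)
  exact le_mul_of_one_le_right (norm_nonneg _) (ω.one_le' x)

/-- The convolution `(f ⋆ g)(x) = ∫ f(t) g(x - t) dt = ∫ f(x - t) g(t) dt` of two elements of
`L¹(ℝ, ω, 𝒜)`, as a function. -/
noncomputable def conv (f g : BeurlingL1 ω 𝒜) : ℝ → 𝒜 :=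
  (f.1 : ℝ → 𝒜) ⋆[ContinuousLinearMap.mul ℂ 𝒜, volume] (g.1 : ℝ → 𝒜)

theorem conv_apply (f g : BeurlingL1 ω 𝒜) (x : ℝ) :
    conv f g x = ∫ t, f.1 (x - t) * g.1 t := by
  rw [conv, convolution_eq_swap]; rfl

theorem integrable_conv (f g : BeurlingL1 ω 𝒜) : Integrable (conv f g) volume :=
  f.integrable.integrable_convolution _ g.integrable

theorem integrable_norm_conv_mul (f g : BeurlingL1 ω 𝒜) :
    Integrable (fun x => ‖conv f g x‖ * ω x) volume := by
  refine (f.integrable_norm_mul.integrable_convolution (ContinuousLinearMap.mul ℝ ℝ)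
    g.integrable_norm_mul).mono'
    ((integrable_conv f g).aestronglyMeasurable.norm.mul ω.measurable'.aestronglyMeasurable) ?_
  filter_upwards [f.integrable_norm_mul.ae_convolution_exists (ContinuousLinearMap.mul ℝ ℝ)
    g.integrable_norm_mul] with x hx
  have h0 : ∀ y, 0 ≤ ω y := fun y => zero_le_one.trans (ω.one_le' y)
  rw [Real.norm_of_nonneg (mul_nonneg (norm_nonneg _) (h0 x))]
  calc ‖conv f g x‖ * ω x
      ≤ (∫ t, ‖f.1 t * g.1 (x - t)‖) * ω x :=
        mul_le_mul_of_nonneg_right (norm_integral_le_integral_norm _) (h0 x)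
    _ = ∫ t, ‖f.1 t * g.1 (x - t)‖ * ω x := (integral_mul_const _ _).symm
    _ ≤ ∫ t, (‖f.1 t‖ * ω t) * (‖g.1 (x - t)‖ * ω (x - t)) := by
        refine integral_mono_of_nonneg
          (.of_forall fun t => mul_nonneg (norm_nonneg _) (h0 x)) hx (.of_forall fun t => ?_)
        have h1 : ω x ≤ ω t * ω (x - t) := by
          simpa using ω.map_add_le_mul' t (x - t)
        calc ‖f.1 t * g.1 (x - t)‖ * ω x
            ≤ (‖f.1 t‖ * ‖g.1 (x - t)‖) * (ω t * ω (x - t)) :=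
              mul_le_mul (norm_mul_le _ _) h1 (h0 x) (by positivity)
          _ = _ := by ring
    _ = _ := rfl

/-- The product on `L¹(ℝ, ω, 𝒜)` is convolution. -/
noncomputable instance : Mul (BeurlingL1 ω 𝒜) where
  mul f g := ⟨AEEqFun.mk (conv f g) (integrable_conv f g).aestronglyMeasurable, by
    refine (integrable_norm_conv_mul f g).congr ?_
    filter_upwards [AEEqFun.coeFn_mk (conv f g) (integrable_conv f g).aestronglyMeasurable]
      with x hx
    rw [hx]⟩

theorem coeFn_mul (f g : BeurlingL1 ω 𝒜) :
    ((f * g : BeurlingL1 ω 𝒜).1 : ℝ → 𝒜) =ᵐ[volume] conv f g :=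
  AEEqFun.coeFn_mk _ _

theorem ext_ae {f g : BeurlingL1 ω 𝒜} (h : (f.1 : ℝ → 𝒜) =ᵐ[volume] (g.1 : ℝ → 𝒜)) : f = g :=
  Subtype.ext (AEEqFun.ext h)

theorem conv_ae_exists (f g : BeurlingL1 ω 𝒜) :
    ∀ᵐ x, ConvolutionExistsAt (f.1 : ℝ → 𝒜) (g.1 : ℝ → 𝒜) x (ContinuousLinearMap.mul ℂ 𝒜) volume :=
  f.integrable.ae_convolution_exists _ g.integrable

theorem mul_add_aux (f g h : BeurlingL1 ω 𝒜) : f * (g + h) = f * g + f * h := by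
  refine ext_ae ?_
  filter_upwards [coeFn_mul f (g + h), coeFn_mul f g, coeFn_mul f h,
    AEEqFun.coeFn_add (f * g).1 (f * h).1, conv_ae_exists f g, conv_ae_exists f h]
    with x h1 h2 h3 h4 h5 h6
  rw [h1, Submodule.coe_add, h4, Pi.add_apply, h2, h3, conv, Submodule.coe_add,
    convolution_congr _ (Filter.EventuallyEq.refl _ _) (AEEqFun.coeFn_add g.1 h.1)]
  exact h5.distrib_add h6

theorem add_mul_aux (f g h : BeurlingL1 ω 𝒜) : (f + g) * h = f * h + g * h := by
  refine ext_ae ?_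
  filter_upwards [coeFn_mul (f + g) h, coeFn_mul f h, coeFn_mul g h,
    AEEqFun.coeFn_add (f * h).1 (g * h).1, conv_ae_exists f h, conv_ae_exists g h]
    with x h1 h2 h3 h4 h5 h6
  rw [h1, Submodule.coe_add, h4, Pi.add_apply, h2, h3, conv, Submodule.coe_add,
    convolution_congr _ (AEEqFun.coeFn_add f.1 g.1) (Filter.EventuallyEq.refl _ _)]
  exact h5.add_distrib h6

theorem smul_mul_aux (c : ℂ) (f g : BeurlingL1 ω 𝒜) : (c • f) * g = c • (f * g) := by
  refine ext_ae ?_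
  filter_upwards [coeFn_mul (c • f) g, coeFn_mul f g, AEEqFun.coeFn_smul c (f * g).1]
    with x h1 h2 h3
  rw [h1, Submodule.coe_smul, h3, Pi.smul_apply, h2, conv, Submodule.coe_smul,
    convolution_congr _ (AEEqFun.coeFn_smul c f.1) (Filter.EventuallyEq.refl _ _),
    smul_convolution]
  rfl

theorem mul_smul_aux (c : ℂ) (f g : BeurlingL1 ω 𝒜) : f * (c • g) = c • (f * g) := by
  refine ext_ae ?_
  filter_upwards [coeFn_mul f (c • g), coeFn_mul f g, AEEqFun.coeFn_smul c (f * g).1]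
    with x h1 h2 h3
  rw [h1, Submodule.coe_smul, h3, Pi.smul_apply, h2, conv, Submodule.coe_smul,
    convolution_congr _ (Filter.EventuallyEq.refl _ _) (AEEqFun.coeFn_smul c g.1),
    convolution_smul]
  rfl

theorem mul_assoc_aux [CompleteSpace 𝒜] (f g h : BeurlingL1 ω 𝒜) : f * g * h = f * (g * h) := by
  refine ext_ae ?_
  have hgh := g.integrable.norm.integrable_convolution (ContinuousLinearMap.mul ℝ ℝ)
    h.integrable.norm
  filter_upwards [coeFn_mul (f * g) h, coeFn_mul f (g * h),
    f.integrable.norm.ae_convolution_exists (ContinuousLinearMap.mul ℝ ℝ) hgh] with x h1 h2 h3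
  rw [h1, h2, conv, conv, convolution_congr _ (coeFn_mul f g) (Filter.EventuallyEq.refl _ _),
    convolution_congr _ (Filter.EventuallyEq.refl _ _) (coeFn_mul g h), conv, conv]
  exact convolution_assoc _ _ _ _ (fun a b c => mul_assoc a b c) f.1.aestronglyMeasurable
    g.1.aestronglyMeasurable h.1.aestronglyMeasurable (conv_ae_exists f g)
    (g.integrable.norm.ae_convolution_exists _ h.integrable.norm) h3

/-- `L¹(ℝ, ω, 𝒜)` is a (non-unital) algebra under convolution. -/
noncomputable instance [CompleteSpace 𝒜] : NonUnitalRing (BeurlingL1 ω 𝒜) where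
  left_distrib := mul_add_aux
  right_distrib := add_mul_aux
  zero_mul f := by simpa using smul_mul_aux 0 f f
  mul_zero f := by simpa using mul_smul_aux 0 f f
  mul_assoc := mul_assoc_aux

instance : IsScalarTower ℂ (BeurlingL1 ω 𝒜) (BeurlingL1 ω 𝒜) := ⟨smul_mul_aux⟩

instance : SMulCommClass ℂ (BeurlingL1 ω 𝒜) (BeurlingL1 ω 𝒜) :=
  ⟨fun c f g => (mul_smul_aux c f g).symm⟩

/-- The inclusion `L¹(ℝ, ω, 𝒜) ⊆ L¹(ℝ, ν, 𝒜)` for weights `ν ≤ ω`. -/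
def incl (h : ∀ x, ν x ≤ ω x) (f : BeurlingL1 ω 𝒜) : BeurlingL1 ν 𝒜 :=
  ⟨f.1, by
    refine f.integrable_norm_mul.mono'
      (f.1.aestronglyMeasurable.norm.mul ν.measurable'.aestronglyMeasurable)
      (.of_forall fun x => ?_)
    rw [Real.norm_of_nonneg (mul_nonneg (norm_nonneg _) (zero_le_one.trans (ν.one_le' x)))]
    exact mul_le_mul_of_nonneg_left (h x) (norm_nonneg _)⟩

/-- The Fourier transform `t ↦ ∫ f(x) e^{itx} dx` of `f ∈ L¹(ℝ, ω, 𝒜)`. -/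
noncomputable def fourier (f : BeurlingL1 ω 𝒜) (t : ℝ) : 𝒜 :=
  ∫ x : ℝ, Complex.exp (Complex.I * (t : ℂ) * (x : ℂ)) • f.1 x

/-- The element `𝟏 + f` of the unitization `L¹(ℝ, ω, 𝒜)_𝟏 = L¹(ℝ, ω, 𝒜) × ℂ`. -/
noncomputable def oneAdd (f : BeurlingL1 ω 𝒜) : Unitization ℂ (BeurlingL1 ω 𝒜) :=
  1 + Unitization.inr f

end BeurlingL1

/-! Everything reduces to admissible weights. Since `exp y ≥ 1 + y`, every weight dominates the
piecewise linear weight with slopes `ρ₂` and `-ρ₁`. That weight is admissible, and it is nonconstant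
unless both slopes vanish, so a non-admissible `ω` may be replaced by it; an admissible `ω` is kept.

For an admissible weight, the proof is a noncommutative form of Gelfand's argument for Wiener's
lemma. Put `u = -f`. A left inverse `𝟏 + g` exists exactly when `u` lies in the left ideal `J` of
all `g + g * f = g - g * u`, and `u` is a right unit modulo `J`. If `u ∉ J`, Zorn's lemma gives a
closed subspace `M ⊇ J` omitting `u` that is maximal among subspaces stable under convolution from
the left, translations and left multiplication by `𝒜`. Translations commute with all these
operators, so by Schur's lemma (nonemptiness of the spectrum on the quotient) they act modulo `M` by
scalars `χ s`. Then `χ` is a continuous character dominated by a multiple of the weight, and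
admissibility forces `χ s = exp (i t s)` with `t` real.

Convolution is a vector-valued integral of translates (`mul_eq_integral`), hence `g * u ≡ ĝ(t) u`
modulo `M`. Taking `g = u` and using that `u` is a right unit modulo `M` gives `(1 + f̂(t)) u ∈ M`;
a left inverse of `1 + f̂(t)` then puts `u` in `M`, a contradiction (`exists_add_mul_eq_neg`). The
right-sided case is the left-sided one over the opposite algebra. -/

open Filter Topology

/-! ### Continuous characters of the line -/

/-- A continuous homomorphism from `(ℝ, +)` to `(ℂ, *)` with `χ 0 = 1` is an exponential. -/
theorem exists_eq_cexp_of_continuous {χ : ℝ → ℂ} (hc : Continuous χ) (h0 : χ 0 = 1)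
    (hadd : ∀ x y, χ (x + y) = χ x * χ y) : ∃ z : ℂ, ∀ x : ℝ, χ x = Complex.exp (z * x) := by
  have hF : ∀ x, HasDerivAt (fun y => ∫ s in (0:ℝ)..y, χ s) (χ x) x := fun x =>
    intervalIntegral.integral_hasDerivAt_right (hc.intervalIntegrable _ _)
      hc.stronglyMeasurable.stronglyMeasurableAtFilter hc.continuousAt
  obtain ⟨a, ha⟩ : ∃ a, (∫ s in (0:ℝ)..a, χ s) ≠ 0 := by
    by_contra! h
    have h1 := hF 0
    simp only [h, h0] at h1
    exact one_ne_zero (h1.unique (hasDerivAt_const _ _))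
  set c := ∫ s in (0:ℝ)..a, χ s with hcdef
  -- Multiplicativity gives `χ x * c = ∫ χ` over `[x, x + a]`, so the continuous `χ` is a difference
  -- of primitives and hence differentiable.
  have hχ : ∀ x, χ x = ((∫ s in (0:ℝ)..(x + a), χ s) - ∫ s in (0:ℝ)..x, χ s) * c⁻¹ := by
    intro x
    rw [intervalIntegral.integral_interval_sub_left (hc.intervalIntegrable _ _)
      (hc.intervalIntegrable _ _), eq_mul_inv_iff_mul_eq₀ ha, hcdef,
      ← intervalIntegral.integral_const_mul]
    simp_rw [← hadd]
    rw [intervalIntegral.integral_comp_add_left (fun y => χ y) x, add_zero]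
  have hd : ∀ x, DifferentiableAt ℝ χ x := by
    intro x
    have h1 : HasDerivAt (fun y => ((∫ s in (0:ℝ)..(y + a), χ s) - ∫ s in (0:ℝ)..y, χ s) * c⁻¹)
        ((χ (x + a) - χ x) * c⁻¹) x :=
      (((hF (x + a)).comp_add_const x a).sub (hF x)).mul_const _
    rw [funext hχ]
    exact h1.differentiableAt
  set z := deriv χ 0
  have hder : ∀ x, HasDerivAt χ (χ x * z) x := by
    intro x
    have h1 : HasDerivAt (fun y => χ x * χ (y - x)) (χ x * z) x := by
      refine HasDerivAt.const_mul _ ?_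
      refine HasDerivAt.comp_sub_const x x (f := χ) ?_
      rw [sub_self]
      exact (hd 0).hasDerivAt
    refine h1.congr_of_eventuallyEq (.of_forall fun y => ?_)
    change χ y = χ x * χ (y - x)
    rw [← hadd, add_sub_cancel]
  have hexp : ∀ x : ℝ, HasDerivAt (fun y : ℝ => Complex.exp (-(z * y)))
      (Complex.exp (-(z * x)) * -(z * 1)) x := fun x =>
    (((hasDerivAt_id x).ofReal_comp.const_mul z).neg).cexp
  refine ⟨z, fun x => ?_⟩
  have hconst : ∀ x, χ x * Complex.exp (-(z * x)) = χ 0 * Complex.exp (-(z * (0:ℝ))) := by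
    intro x
    refine is_const_of_deriv_eq_zero (f := fun y : ℝ => χ y * Complex.exp (-(z * y)))
      (fun y => ((hder y).mul (hexp y)).differentiableAt) (fun y => ?_) x 0
    rw [((hder y).fun_mul (hexp y)).deriv]
    ring
  have h2 := hconst x
  rw [h0, Complex.exp_neg] at h2
  field_simp at h2
  simpa using h2

/-! ### Growth of weights and reduction to the admissible case -/

namespace BeurlingWeight

variable (ω : BeurlingWeight)

theorem pos (x : ℝ) : 0 < ω x := one_pos.trans_le (ω.one_le' x)

theorem log_nonneg (x : ℝ) : 0 ≤ Real.log (ω x) := Real.log_nonneg (ω.one_le' x)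

theorem map_nsmul_le_pow (x : ℝ) (n : ℕ) : ω (n * x) ≤ ω 0 * ω x ^ n := by
  induction n with
  | zero => simp
  | succ k ih =>
    calc ω ((k + 1 : ℕ) * x) = ω (k * x + x) := by push_cast; ring_nf
      _ ≤ ω (k * x) * ω x := ω.map_add_le_mul' _ _
      _ ≤ ω 0 * ω x ^ k * ω x := by gcongr; exact (ω.pos x).le
      _ = _ := by ring

theorem rho₂_le {x : ℝ} (hx : 0 < x) : ω.rho₂ ≤ Real.log (ω x) / x := by
  refine csInf_le ⟨0, ?_⟩ ⟨x, hx, rfl⟩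
  rintro _ ⟨y, hy, rfl⟩
  exact div_nonneg (ω.log_nonneg y) (Set.mem_Ioi.1 hy).le

theorem le_rho₁ {x : ℝ} (hx : x < 0) : Real.log (ω x) / x ≤ ω.rho₁ := by
  refine le_csSup ⟨0, ?_⟩ ⟨x, hx, rfl⟩
  rintro _ ⟨y, hy, rfl⟩
  exact div_nonpos_of_nonneg_of_nonpos (ω.log_nonneg y) (Set.mem_Iio.1 hy).le

theorem rho₂_nonneg : 0 ≤ ω.rho₂ := by
  refine le_csInf (Set.nonempty_Ioi.image _) ?_
  rintro _ ⟨y, hy, rfl⟩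
  exact div_nonneg (ω.log_nonneg y) (Set.mem_Ioi.1 hy).le

theorem rho₁_nonpos : ω.rho₁ ≤ 0 := by
  refine csSup_le (Set.nonempty_Iio.image _) ?_
  rintro _ ⟨y, hy, rfl⟩
  exact div_nonpos_of_nonneg_of_nonpos (ω.log_nonneg y) (Set.mem_Iio.1 hy).le

/-- A weight is bounded near the origin, by the Steinhaus theorem. -/
theorem exists_forall_nhds_zero_le : ∃ C, ∀ᶠ x in 𝓝 (0:ℝ), ω x ≤ C := by
  -- The sets are symmetrized because the estimate on a difference `x - y` involves `ω (-y)`.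
  let S : ℕ → Set ℝ := fun n => {x | ω x ≤ n ∧ ω (-x) ≤ n}
  have hS : ∀ n, MeasurableSet (S n) := fun n =>
    (measurableSet_le ω.measurable' measurable_const).inter
      (measurableSet_le (ω.measurable'.comp measurable_neg) measurable_const)
  have hU : (⋃ n, S n) = Set.univ := by
    refine Set.eq_univ_of_forall fun x => Set.mem_iUnion.2 ?_
    obtain ⟨n, hn⟩ := exists_nat_ge (max (ω x) (ω (-x)))
    exact ⟨n, (le_max_left _ _).trans hn, (le_max_right _ _).trans hn⟩
  obtain ⟨n, hn⟩ : ∃ n, 0 < volume (S n) := by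
    refine exists_measure_pos_of_not_measure_iUnion_null ?_
    rw [hU]
    simp
  refine ⟨n * n, ?_⟩
  filter_upwards [Measure.sub_mem_nhds_zero_of_addHaar_pos volume (S n) (hS n) hn]
  rintro _ ⟨x, hx, y, hy, rfl⟩
  calc ω (x - y) ≤ ω x * ω (-y) := by simpa [sub_eq_add_neg] using ω.map_add_le_mul' x (-y)
    _ ≤ n * n := mul_le_mul hx.1 hy.2 (ω.pos _).le (by positivity)

/-- The weight `x ↦ 1 + a x⁺ + b x⁻`. -/
noncomputable def linear (a b : ℝ) (ha : 0 ≤ a) (hb : 0 ≤ b) : BeurlingWeight where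
  toFun x := 1 + a * max x 0 + b * max (-x) 0
  measurable' := by fun_prop
  one_le' x := by
    have h1 := mul_nonneg ha (le_max_right x 0)
    have h2 := mul_nonneg hb (le_max_right (-x) 0)
    linarith
  map_add_le_mul' x y := by
    have key : ∀ x y : ℝ, max (x + y) 0 ≤ max x 0 + max y 0 := fun x y =>
      max_le (add_le_add (le_max_left _ _) (le_max_left _ _)) (by positivity)
    have h1 := mul_le_mul_of_nonneg_left (key x y) ha
    have h2 := mul_le_mul_of_nonneg_left (key (-x) (-y)) hb
    rw [← neg_add] at h2
    have h3 : 0 ≤ (a * max x 0 + b * max (-x) 0) * (a * max y 0 + b * max (-y) 0) := by positivity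
    linarith

theorem tendsto_log_one_add_mul_div (a : ℝ) (ha : 0 ≤ a) :
    Tendsto (fun x : ℝ => Real.log (1 + a * x) / x) atTop (𝓝 0) := by
  have hb : Tendsto (fun x : ℝ => (2 * √a) * (√x)⁻¹) atTop (𝓝 0) := by
    simpa using (Real.tendsto_sqrt_atTop.inv_tendsto_atTop).const_mul (2 * √a)
  refine tendsto_of_tendsto_of_tendsto_of_le_of_le' tendsto_const_nhds hb ?_ ?_
  · filter_upwards [eventually_gt_atTop 0] with x hx
    have : 0 ≤ a * x := by positivity
    exact div_nonneg (Real.log_nonneg (by linarith)) hx.le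
  · filter_upwards [eventually_gt_atTop 0] with x hx
    have hax : 0 ≤ a * x := by positivity
    have h1 : Real.log (1 + a * x) ≤ 2 * √(a * x) := by
      calc Real.log (1 + a * x) ≤ Real.log ((1 + √(a * x)) ^ 2) := by
            refine Real.log_le_log (by positivity) ?_
            nlinarith [Real.sq_sqrt hax, Real.sqrt_nonneg (a * x)]
        _ = 2 * Real.log (1 + √(a * x)) := by rw [Real.log_pow]; norm_num
        _ ≤ 2 * √(a * x) := by
            have := Real.log_le_sub_one_of_pos (x := 1 + √(a * x)) (by positivity)
            linarith
    rw [div_le_iff₀ hx]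
    refine h1.trans (le_of_eq ?_)
    rw [Real.sqrt_mul ha, mul_assoc (2 * √a), inv_mul_eq_div, Real.div_sqrt, mul_assoc]

theorem linear_isAdmissible (a b : ℝ) (ha : 0 ≤ a) (hb : 0 ≤ b) :
    (linear a b ha hb).IsAdmissible := by
  constructor
  · have hl := (tendsto_log_one_add_mul_div b hb).neg
    rw [neg_zero] at hl
    refine le_antisymm (rho₁_nonpos _) (le_of_tendsto hl ?_)
    filter_upwards [eventually_gt_atTop 0] with x hx
    refine le_of_eq_of_le ?_ ((linear a b ha hb).le_rho₁ (neg_neg_of_pos hx))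
    simp [linear, div_neg, hx.le]
  · refine le_antisymm (ge_of_tendsto (tendsto_log_one_add_mul_div a ha) ?_) (rho₂_nonneg _)
    filter_upwards [eventually_gt_atTop 0] with x hx
    refine ((linear a b ha hb).rho₂_le hx).trans_eq ?_
    simp [linear, hx.le]

/-- By definition of the exponents, `ω` dominates `exp (ρ₂ x)` on the right half-line and `exp (ρ₁
x)` on the left; `exp y ≥ 1 + y` then weakens exponential growth to linear growth. -/
theorem linear_le (x : ℝ) :
    linear ω.rho₂ (-ω.rho₁) ω.rho₂_nonneg (neg_nonneg.2 ω.rho₁_nonpos) x ≤ ω x := by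
  have hexp : ∀ y, 1 + y ≤ Real.exp y := fun y => by linarith [Real.add_one_le_exp y]
  rcases lt_trichotomy x 0 with hx | rfl | hx
  · have h := (div_le_iff_of_neg hx).1 (ω.le_rho₁ hx)
    rw [Real.le_log_iff_exp_le (ω.pos x)] at h
    refine le_trans ?_ h
    simpa [linear, hx.le] using hexp (ω.rho₁ * x)
  · simpa [linear] using ω.one_le' 0
  · have h := (le_div_iff₀ hx).1 (ω.rho₂_le hx)
    rw [Real.le_log_iff_exp_le (ω.pos x)] at h
    refine le_trans ?_ h
    simpa [linear, hx.le] using hexp (ω.rho₂ * x)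

theorem IsConstant.isAdmissible {ω : BeurlingWeight} (h : ω.IsConstant) : ω.IsAdmissible := by
  obtain ⟨c, hc⟩ := h
  have hl : Tendsto (fun x : ℝ => Real.log c / x) atTop (𝓝 0) :=
    tendsto_const_nhds.div_atTop tendsto_id
  constructor
  · have hl' := hl.neg
    rw [neg_zero] at hl'
    refine le_antisymm ω.rho₁_nonpos (le_of_tendsto hl' ?_)
    filter_upwards [eventually_gt_atTop 0] with x hx
    simpa [hc, div_neg] using ω.le_rho₁ (neg_neg_of_pos hx)
  · refine le_antisymm (ge_of_tendsto hl ?_) ω.rho₂_nonneg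
    filter_upwards [eventually_gt_atTop 0] with x hx
    simpa [hc] using ω.rho₂_le hx

/-- Every weight dominates an admissible weight that is constant only if the given one is. -/
theorem exists_isAdmissible_le :
    ∃ ν : BeurlingWeight, (∀ x, ν x ≤ ω x) ∧ ν.IsAdmissible ∧ (ν.IsConstant ↔ ω.IsConstant) := by
  by_cases hω : ω.IsAdmissible
  · exact ⟨ω, fun _ => le_rfl, hω, Iff.rfl⟩
  · refine ⟨_, ω.linear_le, linear_isAdmissible _ _ _ _, fun ⟨c, hc⟩ => ?_,
      fun h => absurd h.isAdmissible hω⟩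
    -- The values at `0`, `1` and `-1` force both slopes to vanish if the linear weight is constant,
    -- so that `ω` would be admissible.
    have h0 := hc 0
    have h1 := hc 1
    have h2 := hc (-1)
    simp [linear] at h0 h1 h2
    exact absurd ⟨by linarith, by linarith⟩ hω

/-- A character of `ℝ` dominated by an admissible weight is unitary. -/
theorem IsAdmissible.re_eq_zero {ω : BeurlingWeight} (h : ω.IsAdmissible) {z : ℂ} {C : ℝ}
    (hz : ∀ x : ℝ, ‖Complex.exp (z * x)‖ ≤ C * ω x) : z.re = 0 := by
  have hC : 0 ≤ C := by
    have := (norm_nonneg _).trans (hz 0)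
    exact nonneg_of_mul_nonneg_left this (ω.pos 0)
  have key : ∀ x : ℝ, z.re * x ≤ Real.log (ω x) := by
    intro x
    -- The hypothesis at `n * x` gives `exp (n d) ≤ C * ω 0`, where `d` is the excess of `z.re * x`
    -- over `log (ω x)`. As `n` is arbitrary, `d` cannot be positive, which removes the constant
    -- `C`.
    have hn : ∀ n : ℕ, n * (z.re * x - Real.log (ω x)) ≤ C * ω 0 := by
      intro n
      have h1 : Real.exp (n * (z.re * x)) ≤ C * ω 0 * Real.exp (n * Real.log (ω x)) := by
        calc Real.exp (n * (z.re * x)) = ‖Complex.exp (z * ((n * x : ℝ) : ℂ))‖ := by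
              rw [Complex.norm_exp]; congr 1; simp; ring
          _ ≤ C * ω (n * x) := hz _
          _ ≤ C * (ω 0 * ω x ^ n) := by gcongr; exact ω.map_nsmul_le_pow x n
          _ = _ := by rw [Real.exp_nat_mul, Real.exp_log (ω.pos x)]; ring
      rw [← div_le_iff₀ (Real.exp_pos _), ← Real.exp_sub] at h1
      linarith [Real.add_one_le_exp (n * (z.re * x) - n * Real.log (ω x))]
    by_contra! hlt
    obtain ⟨n, hn'⟩ := exists_nat_gt (C * ω 0 / (z.re * x - Real.log (ω x)))
    rw [div_lt_iff₀ (by linarith)] at hn'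
    linarith [hn n]
  refine le_antisymm ?_ ?_
  · rw [← h.2]
    refine le_csInf (Set.nonempty_Ioi.image _) ?_
    rintro _ ⟨y, hy, rfl⟩
    exact (le_div_iff₀ hy).2 (key y)
  · rw [← h.1]
    refine csSup_le (Set.nonempty_Iio.image _) ?_
    rintro _ ⟨y, hy, rfl⟩
    exact (div_le_iff_of_neg hy).2 (key y)

end BeurlingWeight

/-! ### Maximal invariant subspaces and Schur's lemma -/

/-- A subspace is invariant under a set of operators. -/
def Submodule.IsInvariant {E : Type*} [NormedAddCommGroup E] [NormedSpace ℂ E]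
    (R : Set (E →L[ℂ] E)) (M : Submodule ℂ E) : Prop :=
  ∀ S ∈ R, ∀ x ∈ M, S x ∈ M

section

variable {E : Type*} [NormedAddCommGroup E] [NormedSpace ℂ E] {R : Set (E →L[ℂ] E)}

theorem Submodule.IsInvariant.topologicalClosure {M : Submodule ℂ E} (h : M.IsInvariant R) :
    M.topologicalClosure.IsInvariant R := by
  intro S hS x hx
  exact map_mem_closure S.continuous hx fun y hy => h S hS y hy

/-- A maximal closed invariant subspace: an invariant `J` whose proper invariant enlargements are
those omitting `u`, and stay away from `u`, lies in a closed invariant subspace omitting `u`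
that is maximal with these properties. -/
theorem exists_maximal_isInvariant {J : Submodule ℂ E} (hJ : J.IsInvariant R) {u : E}
    (hu : u ∉ J)
    (hclosure : ∀ M : Submodule ℂ E, M.IsInvariant R → J ≤ M → u ∈ M.topologicalClosure → u ∈ M) :
    ∃ M : Submodule ℂ E, M.IsInvariant R ∧ J ≤ M ∧ u ∉ M ∧ IsClosed (M : Set E) ∧
      ∀ N : Submodule ℂ E, N.IsInvariant R → M ≤ N → u ∉ N → N = M := by
  obtain ⟨M, hJM, hM⟩ := zorn_le_nonempty₀
    {M : Submodule ℂ E | M.IsInvariant R ∧ u ∉ M} (fun c hc hchain y hy => by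
      have hdir : DirectedOn (· ≤ ·) c := hchain.directedOn
      refine ⟨sSup c, ⟨fun S hS x hx => ?_, fun hx => ?_⟩, fun z hz => le_sSup hz⟩
      · rw [Submodule.mem_sSup_of_directed ⟨y, hy⟩ hdir] at hx ⊢
        obtain ⟨N, hN, hxN⟩ := hx
        exact ⟨N, hN, (hc hN).1 S hS x hxN⟩
      · rw [Submodule.mem_sSup_of_directed ⟨y, hy⟩ hdir] at hx
        obtain ⟨N, hN, hxN⟩ := hx
        exact (hc hN).2 hxN) J ⟨hJ, hu⟩
  have hmax : ∀ N : Submodule ℂ E, N.IsInvariant R → M ≤ N → u ∉ N → N = M :=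
    fun N hN hMN huN => le_antisymm (hM.le_of_ge ⟨hN, huN⟩ hMN) hMN
  refine ⟨M, hM.prop.1, hJM, hM.prop.2, ?_, hmax⟩
  -- By `hclosure` the closure of `M` still omits `u`, so maximality makes `M` closed.
  have h1 := hmax M.topologicalClosure hM.prop.1.topologicalClosure M.le_topologicalClosure
    fun h => hM.prop.2 (hclosure M hM.prop.1 hJM h)
  rw [← h1]
  exact M.isClosed_topologicalClosure

/-- Schur's lemma: an operator that belongs to `R` and commutes with `R` is scalar modulo a
maximal closed invariant subspace. -/
theorem exists_sub_smul_mem_of_maximal [CompleteSpace E] {M : Submodule ℂ E} {u : E}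
    (hM : M.IsInvariant R) (hu : u ∉ M) (hcl : IsClosed (M : Set E))
    (hmax : ∀ N : Submodule ℂ E, N.IsInvariant R → M ≤ N → u ∉ N → N = M)
    (htop : ∀ N : Submodule ℂ E, N.IsInvariant R → M ≤ N → u ∈ N → N = ⊤)
    {T : E →L[ℂ] E} (hT : T ∈ R) (hcomm : ∀ S ∈ R, ∀ x, S (T x) = T (S x)) :
    ∃ c : ℂ, ∀ x, T x - c • x ∈ M := by
  have hdich : ∀ N : Submodule ℂ E, N.IsInvariant R → M ≤ N → N = M ∨ N = ⊤ := fun N hN hMN => by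
    by_cases h : u ∈ N
    · exact .inr (htop N hN hMN h)
    · exact .inl (hmax N hN hMN h)
  by_contra! hno
  have : IsClosed (M : Set E) := hcl
  have hTM : ∀ x ∈ M, T x ∈ M := hM T hT
  let T' : (E ⧸ M) →L[ℂ] (E ⧸ M) :=
    { toLinearMap := M.mapQ M T.toLinearMap hTM
      cont := by
        refine (Submodule.isOpenQuotientMap_mkQ M).isQuotientMap.continuous_iff.2 ?_
        exact (M.isOpenQuotientMap_mkQ.continuous.comp T.continuous) }
  have hT' : ∀ x, T' (Submodule.Quotient.mk x) = Submodule.Quotient.mk (T x) := fun x => rfl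
  have : Nontrivial (E ⧸ M) :=
    ⟨Submodule.Quotient.mk u, 0, fun h => hu ((Submodule.Quotient.mk_eq_zero M).1 h)⟩
  -- The quotient is a nonzero complex Banach space, so the induced operator has a spectral value
  -- `c`. If no scalar works, the dichotomy makes `c - T'` injective (through its kernel) and
  -- surjective (through its range), contradicting the choice of `c`.
  obtain ⟨c, hc⟩ := spectrum.nonempty T'
  have hmk : ∀ x, (algebraMap ℂ ((E ⧸ M) →L[ℂ] (E ⧸ M)) c - T') (Submodule.Quotient.mk x) =
      Submodule.Quotient.mk (c • x - T x) := fun x => rfl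
  refine hc (ContinuousLinearMap.isUnit_iff_bijective.2 ⟨?_, ?_⟩)
  · let N : Submodule ℂ E := M.comap (c • LinearMap.id - T.toLinearMap)
    have hNmem : ∀ x, x ∈ N ↔ c • x - T x ∈ M := fun x => Iff.rfl
    rcases hdich N (fun S hS x hx => by
        rw [hNmem] at hx ⊢
        have := hM S hS _ hx
        rwa [map_sub, map_smul, hcomm S hS] at this)
        (fun x hx => M.sub_mem (M.smul_mem c hx) (hTM x hx)) with h | h
    · rw [injective_iff_map_eq_zero]
      intro q hq
      obtain ⟨x, rfl⟩ := Submodule.Quotient.mk_surjective M q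
      rw [hmk, Submodule.Quotient.mk_eq_zero, ← hNmem, h] at hq
      exact (Submodule.Quotient.mk_eq_zero M).2 hq
    · obtain ⟨x, hx⟩ := hno c
      refine absurd ?_ hx
      have : x ∈ N := h ▸ Submodule.mem_top
      rw [hNmem] at this
      simpa using M.neg_mem this
  · let N : Submodule ℂ E := M ⊔ LinearMap.range (c • LinearMap.id - T.toLinearMap)
    rcases hdich N (fun S hS x hx => by
        obtain ⟨m, hm, _, ⟨y, rfl⟩, rfl⟩ := Submodule.mem_sup.1 hx
        rw [map_add]
        refine N.add_mem (Submodule.mem_sup_left (hM S hS m hm))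
          (Submodule.mem_sup_right ⟨S y, ?_⟩)
        change c • S y - T (S y) = S (c • y - T y)
        rw [map_sub, map_smul, hcomm S hS]) le_sup_left with h | h
    · obtain ⟨x, hx⟩ := hno c
      refine absurd ?_ hx
      have : c • x - T x ∈ N := Submodule.mem_sup_right ⟨x, rfl⟩
      rw [h] at this
      simpa using M.neg_mem this
    · intro q
      obtain ⟨x, rfl⟩ := Submodule.Quotient.mk_surjective M q
      have : x ∈ N := h ▸ Submodule.mem_top
      obtain ⟨m, hm, _, ⟨y, rfl⟩, rfl⟩ := Submodule.mem_sup.1 this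
      refine ⟨Submodule.Quotient.mk y, ?_⟩
      rw [hmk]
      refine (Submodule.Quotient.eq M).2 ?_
      change c • y - T y - (m + (c • y - T y)) ∈ M
      simpa using hm

end

/-! ### The weighted space as a Banach space -/

namespace BeurlingL1

variable {ω : BeurlingWeight} {𝒜 : Type*} [NormedRing 𝒜] [NormedAlgebra ℂ 𝒜]

/-- The element of `L¹(ℝ, ω, 𝒜)` represented by a function. -/
noncomputable def ofFun (F : ℝ → 𝒜) (hm : AEStronglyMeasurable F volume)
    (hF : Integrable (fun x => ‖F x‖ * ω x) volume) : BeurlingL1 ω 𝒜 :=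
  ⟨AEEqFun.mk F hm, hF.congr (by
    filter_upwards [AEEqFun.coeFn_mk F hm] with x hx
    rw [hx])⟩

theorem coeFn_ofFun (F : ℝ → 𝒜) (hm : AEStronglyMeasurable F volume)
    (hF : Integrable (fun x => ‖F x‖ * ω x) volume) :
    ((ofFun F hm hF : BeurlingL1 ω 𝒜).1 : ℝ → 𝒜) =ᵐ[volume] F :=
  AEEqFun.coeFn_mk F hm

theorem coeFn_add (f g : BeurlingL1 ω 𝒜) :
    ((f + g : BeurlingL1 ω 𝒜).1 : ℝ → 𝒜) =ᵐ[volume] fun x => f.1 x + g.1 x :=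
  AEEqFun.coeFn_add f.1 g.1

theorem coeFn_sub (f g : BeurlingL1 ω 𝒜) :
    ((f - g : BeurlingL1 ω 𝒜).1 : ℝ → 𝒜) =ᵐ[volume] fun x => f.1 x - g.1 x :=
  AEEqFun.coeFn_sub f.1 g.1

theorem coeFn_neg (f : BeurlingL1 ω 𝒜) :
    ((-f : BeurlingL1 ω 𝒜).1 : ℝ → 𝒜) =ᵐ[volume] fun x => -f.1 x :=
  AEEqFun.coeFn_neg f.1

theorem coeFn_smul (c : ℂ) (f : BeurlingL1 ω 𝒜) :
    ((c • f : BeurlingL1 ω 𝒜).1 : ℝ → 𝒜) =ᵐ[volume] fun x => c • f.1 x :=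
  AEEqFun.coeFn_smul c f.1

theorem norm_ofReal_smul (x : ℝ) (a : 𝒜) : ‖((ω x : ℝ) : ℂ) • a‖ = ‖a‖ * ω x := by
  rw [norm_smul, Complex.norm_real, Real.norm_of_nonneg (ω.pos x).le, mul_comm]

theorem integrable_weight_smul (f : BeurlingL1 ω 𝒜) :
    Integrable (fun x => ((ω x : ℝ) : ℂ) • f.1 x) volume := by
  refine f.integrable_norm_mul.mono' ?_ (.of_forall fun x => (norm_ofReal_smul x _).le)
  exact (Complex.measurable_ofReal.comp ω.measurable').aestronglyMeasurable.smul
    f.1.aestronglyMeasurable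

variable (ω 𝒜) in
/-- Multiplication by the weight, from `L¹(ℝ, ω, 𝒜)` to `L¹(ℝ, 𝒜)`. -/
noncomputable def weightMul : BeurlingL1 ω 𝒜 →ₗ[ℂ] (ℝ →₁[volume] 𝒜) where
  toFun f := f.integrable_weight_smul.toL1 _
  map_add' f g := by
    rw [← Integrable.toL1_add, Integrable.toL1_eq_toL1_iff]
    filter_upwards [coeFn_add f g] with x hx
    rw [hx, Pi.add_apply, smul_add]
  map_smul' c f := by
    rw [RingHom.id_apply, ← Integrable.toL1_smul', Integrable.toL1_eq_toL1_iff]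
    filter_upwards [coeFn_smul c f] with x hx
    rw [hx, Pi.smul_apply, smul_comm]

theorem weightMul_injective : Function.Injective (weightMul ω 𝒜) := by
  intro f g h
  refine ext_ae ?_
  filter_upwards [(Integrable.toL1_eq_toL1_iff _ _ f.integrable_weight_smul
    g.integrable_weight_smul).1 h] with x hx
  exact smul_right_injective 𝒜 (Complex.ofReal_ne_zero.2 (ω.pos x).ne') hx

theorem weightMul_surjective : Function.Surjective (weightMul ω 𝒜) := by
  intro F
  have hm : AEStronglyMeasurable (fun x => (((ω x)⁻¹ : ℝ) : ℂ) • F x) volume :=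
    (Complex.measurable_ofReal.comp ω.measurable'.inv).aestronglyMeasurable.smul
      (Lp.aestronglyMeasurable F)
  have hω : ∀ x, (ω x : ℂ) ≠ 0 := fun x => Complex.ofReal_ne_zero.2 (ω.pos x).ne'
  have hint : Integrable (fun x => ‖(((ω x)⁻¹ : ℝ) : ℂ) • F x‖ * ω x) volume :=
    (L1.integrable_coeFn F).norm.congr (.of_forall fun x => by
      change ‖F x‖ = ‖(((ω x)⁻¹ : ℝ) : ℂ) • F x‖ * ω x
      rw [← norm_ofReal_smul, smul_smul, Complex.ofReal_inv, mul_inv_cancel₀ (hω x), one_smul])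
  refine ⟨ofFun _ hm hint, ?_⟩
  refine Eq.trans ((Integrable.toL1_eq_toL1_iff _ _ (integrable_weight_smul _)
    (L1.integrable_coeFn F)).2 ?_) (Integrable.toL1_coeFn F _)
  filter_upwards [coeFn_ofFun (ω := ω) _ hm hint] with x hx
  rw [hx, smul_smul, Complex.ofReal_inv, mul_inv_cancel₀ (hω x), one_smul]

/-- The norm is pulled back from unweighted `L¹` along the bijection `weightMul`, so completeness is
inherited. -/
noncomputable instance : NormedAddCommGroup (BeurlingL1 ω 𝒜) :=
  NormedAddCommGroup.induced _ _ (weightMul ω 𝒜) weightMul_injective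

noncomputable instance : NormedSpace ℂ (BeurlingL1 ω 𝒜) :=
  NormedSpace.induced ℂ _ _ (weightMul ω 𝒜)

theorem norm_def (f : BeurlingL1 ω 𝒜) : ‖f‖ = ∫ x, ‖f.1 x‖ * ω x := by
  change ‖f.integrable_weight_smul.toL1 _‖ = _
  rw [L1.norm_of_fun_eq_integral_norm]
  simp_rw [norm_ofReal_smul]

instance [CompleteSpace 𝒜] : CompleteSpace (BeurlingL1 ω 𝒜) :=
  (IsometryEquiv.mk (Equiv.ofBijective _ ⟨weightMul_injective, weightMul_surjective⟩)
    (AddMonoidHomClass.isometry_of_norm (weightMul ω 𝒜) fun _ => rfl)).completeSpace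

theorem norm_le_of_ae_le {f : BeurlingL1 ω 𝒜} {G : ℝ → ℝ} (hG : Integrable G volume)
    (h : ∀ᵐ x, ‖f.1 x‖ * ω x ≤ G x) : ‖f‖ ≤ ∫ x, G x := by
  rw [norm_def]
  exact integral_mono_ae f.integrable_norm_mul hG h

theorem integral_norm_le (f : BeurlingL1 ω 𝒜) : ∫ x, ‖f.1 x‖ ≤ ‖f‖ := by
  rw [norm_def]
  exact integral_mono f.integrable.norm f.integrable_norm_mul fun x =>
    le_mul_of_one_le_right (norm_nonneg _) (ω.one_le' x)

/-! ### Left multiplication by elements of the algebra -/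

omit [NormedAlgebra ℂ 𝒜] in
theorem norm_mul_weight_le (a b : 𝒜) (x : ℝ) : ‖a * b‖ * ω x ≤ ‖a‖ * (‖b‖ * ω x) := by
  rw [← mul_assoc]
  exact mul_le_mul_of_nonneg_right (norm_mul_le _ _) (ω.pos x).le

/-- Left multiplication by `a : 𝒜`, pointwise, on `L¹(ℝ, ω, 𝒜)`. -/
noncomputable def leftMulFun (a : 𝒜) (f : BeurlingL1 ω 𝒜) : BeurlingL1 ω 𝒜 :=
  ofFun (fun x => a * f.1 x) (f.1.aestronglyMeasurable.const_mul a)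
    ((f.integrable_norm_mul.const_mul ‖a‖).mono'
      ((f.1.aestronglyMeasurable.const_mul a).norm.mul ω.measurable'.aestronglyMeasurable)
      (.of_forall fun x => by
        rw [Real.norm_of_nonneg (mul_nonneg (norm_nonneg _) (ω.pos x).le)]
        exact norm_mul_weight_le _ _ _))

theorem coeFn_leftMulFun (a : 𝒜) (f : BeurlingL1 ω 𝒜) :
    ((leftMulFun a f).1 : ℝ → 𝒜) =ᵐ[volume] fun x => a * f.1 x :=
  coeFn_ofFun _ _ _

/-- Left multiplication by elements of `𝒜` as a continuous bilinear map. -/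
noncomputable def leftMul : 𝒜 →L[ℂ] BeurlingL1 ω 𝒜 →L[ℂ] BeurlingL1 ω 𝒜 :=
  LinearMap.mkContinuous₂
    (LinearMap.mk₂ ℂ leftMulFun
      (fun a b f => ext_ae (by
        filter_upwards [coeFn_leftMulFun (a + b) f, coeFn_leftMulFun a f, coeFn_leftMulFun b f,
          coeFn_add (leftMulFun a f) (leftMulFun b f)] with x h1 h2 h3 h4
        rw [h1, h4, h2, h3, add_mul]))
      (fun c a f => ext_ae (by
        filter_upwards [coeFn_leftMulFun (c • a) f, coeFn_leftMulFun a f,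
          coeFn_smul c (leftMulFun a f)] with x h1 h2 h3
        rw [h1, h3, h2, smul_mul_assoc]))
      (fun a f g => ext_ae (by
        filter_upwards [coeFn_leftMulFun a (f + g), coeFn_leftMulFun a f, coeFn_leftMulFun a g,
          coeFn_add (leftMulFun a f) (leftMulFun a g), coeFn_add f g] with x h1 h2 h3 h4 h5
        rw [h1, h4, h2, h3, h5, mul_add]))
      (fun c a f => ext_ae (by
        filter_upwards [coeFn_leftMulFun a (c • f), coeFn_leftMulFun a f,
          coeFn_smul c (leftMulFun a f), coeFn_smul c f] with x h1 h2 h3 h4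
        rw [h1, h3, h2, h4, mul_smul_comm])))
    1 fun a f => by
      have h := norm_le_of_ae_le (f := leftMulFun a f) (f.integrable_norm_mul.const_mul ‖a‖) (by
        filter_upwards [coeFn_leftMulFun a f] with x hx
        rw [hx]
        exact norm_mul_weight_le _ _ _)
      rwa [integral_const_mul, ← norm_def, ← one_mul ‖a‖] at h

theorem coeFn_leftMul (a : 𝒜) (f : BeurlingL1 ω 𝒜) :
    ((leftMul a f).1 : ℝ → 𝒜) =ᵐ[volume] fun x => a * f.1 x :=
  coeFn_leftMulFun a f

theorem norm_leftMul_le (a : 𝒜) (f : BeurlingL1 ω 𝒜) : ‖leftMul a f‖ ≤ ‖a‖ * ‖f‖ := by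
  refine (ContinuousLinearMap.le_opNorm₂ _ _ _).trans ?_
  rw [← one_mul (‖a‖ * ‖f‖), mul_assoc]
  exact mul_le_mul_of_nonneg_right (LinearMap.mkContinuous₂_norm_le _ zero_le_one _)
    (by positivity)

theorem leftMul_leftMul (a b : 𝒜) (f : BeurlingL1 ω 𝒜) :
    leftMul a (leftMul b f) = leftMul (a * b) f := by
  refine ext_ae ?_
  filter_upwards [coeFn_leftMul a (leftMul b f), coeFn_leftMul b f, coeFn_leftMul (a * b) f]
    with x h1 h2 h3
  rw [h1, h2, h3, mul_assoc]

theorem leftMul_one (f : BeurlingL1 ω 𝒜) : leftMul 1 f = f := by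
  refine ext_ae ?_
  filter_upwards [coeFn_leftMul 1 f] with x h1
  rw [h1, one_mul]

/-! ### Translations -/

theorem ae_comp_sub {p : ℝ → Prop} (h : ∀ᵐ x, p x) (s : ℝ) : ∀ᵐ x, p (x - s) :=
  (measurePreserving_sub_right volume s).quasiMeasurePreserving.ae h

omit [NormedAlgebra ℂ 𝒜] in
theorem norm_translate_weight_le (a : 𝒜) (s x : ℝ) :
    ‖a‖ * ω x ≤ ω s * (‖a‖ * ω (x - s)) := by
  have h : ω x ≤ ω (x - s) * ω s := by simpa using ω.map_add_le_mul' (x - s) s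
  calc ‖a‖ * ω x ≤ ‖a‖ * (ω (x - s) * ω s) := by gcongr
    _ = _ := by ring

theorem integrable_translate (s : ℝ) (f : BeurlingL1 ω 𝒜) :
    Integrable (fun x => ‖f.1 (x - s)‖ * ω (x - s)) volume :=
  f.integrable_norm_mul.comp_sub_right s

theorem aestronglyMeasurable_translate (s : ℝ) (f : BeurlingL1 ω 𝒜) :
    AEStronglyMeasurable (fun x => f.1 (x - s)) volume :=
  f.1.aestronglyMeasurable.comp_measurePreserving (measurePreserving_sub_right volume s)

/-- The translate `x ↦ f (x - s)`. -/
noncomputable def translateFun (s : ℝ) (f : BeurlingL1 ω 𝒜) : BeurlingL1 ω 𝒜 :=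
  ofFun (fun x => f.1 (x - s)) (aestronglyMeasurable_translate s f)
    (((integrable_translate s f).const_mul (ω s)).mono'
      ((aestronglyMeasurable_translate s f).norm.mul ω.measurable'.aestronglyMeasurable)
      (.of_forall fun x => by
        rw [Real.norm_of_nonneg (mul_nonneg (norm_nonneg _) (ω.pos x).le)]
        exact norm_translate_weight_le _ _ _))

theorem coeFn_translateFun (s : ℝ) (f : BeurlingL1 ω 𝒜) :
    ((translateFun s f).1 : ℝ → 𝒜) =ᵐ[volume] fun x => f.1 (x - s) :=
  coeFn_ofFun _ _ _

/-- Translation by `s` as a continuous linear map. -/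
noncomputable def translate (s : ℝ) : BeurlingL1 ω 𝒜 →L[ℂ] BeurlingL1 ω 𝒜 :=
  LinearMap.mkContinuous
    { toFun := translateFun s
      map_add' := fun f g => ext_ae (by
        filter_upwards [coeFn_translateFun s (f + g), coeFn_translateFun s f,
          coeFn_translateFun s g, coeFn_add (translateFun s f) (translateFun s g),
          ae_comp_sub (coeFn_add f g) s] with x h1 h2 h3 h4 h5
        rw [h1, h4, h2, h3, h5])
      map_smul' := fun c f => ext_ae (by
        filter_upwards [coeFn_translateFun s (c • f), coeFn_translateFun s f,
          coeFn_smul c (translateFun s f), ae_comp_sub (coeFn_smul c f) s] with x h1 h2 h3 h4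
        rw [RingHom.id_apply, h1, h3, h2, h4]) }
    (ω s) fun f => by
      have h := norm_le_of_ae_le (f := translateFun s f)
        ((integrable_translate s f).const_mul (ω s)) (by
          filter_upwards [coeFn_translateFun s f] with x hx
          rw [hx]
          exact norm_translate_weight_le _ _ _)
      rwa [integral_const_mul, integral_sub_right_eq_self (fun x => ‖f.1 x‖ * ω x), ← norm_def] at h

theorem coeFn_translate (s : ℝ) (f : BeurlingL1 ω 𝒜) :
    ((translate s f).1 : ℝ → 𝒜) =ᵐ[volume] fun x => f.1 (x - s) :=
  coeFn_translateFun s f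

theorem norm_translate_le (s : ℝ) (f : BeurlingL1 ω 𝒜) : ‖translate s f‖ ≤ ω s * ‖f‖ :=
  ContinuousLinearMap.le_of_opNorm_le _ (LinearMap.mkContinuous_norm_le _ (ω.pos s).le _) f

theorem translate_translate (s r : ℝ) (f : BeurlingL1 ω 𝒜) :
    translate s (translate r f) = translate (s + r) f := by
  refine ext_ae ?_
  filter_upwards [coeFn_translate s (translate r f), ae_comp_sub (coeFn_translate r f) s,
    coeFn_translate (s + r) f] with x h1 h2 h3
  rw [h1, h2, h3, sub_sub]

theorem translate_zero (f : BeurlingL1 ω 𝒜) : translate 0 f = f := by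
  refine ext_ae ?_
  filter_upwards [coeFn_translate 0 f] with x h1
  rw [h1, sub_zero]

theorem leftMul_translate (a : 𝒜) (s : ℝ) (f : BeurlingL1 ω 𝒜) :
    leftMul a (translate s f) = translate s (leftMul a f) := by
  refine ext_ae ?_
  filter_upwards [coeFn_leftMul a (translate s f), coeFn_translate s f,
    coeFn_translate s (leftMul a f), ae_comp_sub (coeFn_leftMul a f) s] with x h1 h2 h3 h4
  rw [h1, h2, h3, h4]

/-- The restriction of `f` to the set where the weight exceeds `n`. -/
noncomputable def tail (n : ℕ) (f : BeurlingL1 ω 𝒜) : BeurlingL1 ω 𝒜 :=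
  ofFun (Set.indicator {x | (n : ℝ) < ω x} f.1)
    (f.1.aestronglyMeasurable.indicator (measurableSet_lt measurable_const ω.measurable'))
    ((f.integrable_norm_mul.indicator (measurableSet_lt measurable_const ω.measurable')).congr
      (.of_forall fun x => by
        change _ = ‖Set.indicator {x | (n : ℝ) < ω x} f.1 x‖ * ω x
        by_cases hx : x ∈ {x | (n : ℝ) < ω x}
        · rw [Set.indicator_of_mem hx, Set.indicator_of_mem hx]
        · rw [Set.indicator_of_notMem hx, Set.indicator_of_notMem hx, norm_zero, zero_mul]))

theorem coeFn_tail (n : ℕ) (f : BeurlingL1 ω 𝒜) :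
    ((tail n f).1 : ℝ → 𝒜) =ᵐ[volume] Set.indicator {x | (n : ℝ) < ω x} f.1 :=
  coeFn_ofFun _ _ _

/-- Dominated convergence: at each `x` the indicator vanishes once `n` reaches `ω x`. -/
theorem tendsto_norm_tail (f : BeurlingL1 ω 𝒜) :
    Tendsto (fun n => ‖tail n f‖) atTop (𝓝 0) := by
  have h : ∀ n, ‖tail n f‖ = ∫ x, Set.indicator {x | (n : ℝ) < ω x} (fun x => ‖f.1 x‖ * ω x) x := by
    intro n
    rw [norm_def]
    refine integral_congr_ae ?_
    filter_upwards [coeFn_tail n f] with x hx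
    rw [hx]
    by_cases hx : x ∈ {x | (n : ℝ) < ω x}
    · rw [Set.indicator_of_mem hx, Set.indicator_of_mem hx]
    · rw [Set.indicator_of_notMem hx, Set.indicator_of_notMem hx, norm_zero, zero_mul]
  simp_rw [h]
  rw [← integral_zero ℝ ℝ]
  refine tendsto_integral_of_dominated_convergence (fun x => ‖f.1 x‖ * ω x) (fun n =>
    (f.integrable_norm_mul.indicator
      (measurableSet_lt measurable_const ω.measurable')).aestronglyMeasurable)
    f.integrable_norm_mul (fun n => .of_forall fun x => ?_) (.of_forall fun x => ?_)
  · refine (norm_indicator_le_norm_self _ _).trans_eq ?_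
    exact Real.norm_of_nonneg (mul_nonneg (norm_nonneg _) (ω.pos x).le)
  · refine tendsto_const_nhds.congr' ?_
    obtain ⟨N, hN⟩ := exists_nat_ge (ω x)
    filter_upwards [eventually_ge_atTop N] with n hn
    rw [Set.indicator_of_notMem]
    have : (N : ℝ) ≤ n := by exact_mod_cast hn
    simp only [Set.mem_ofPred_eq, not_lt]
    linarith

omit [NormedAlgebra ℂ 𝒜] in
theorem tendsto_integral_norm_sub_translate {g : ℝ → 𝒜} (hg : Integrable g volume) :
    Tendsto (fun s : ℝ => ∫ x, ‖g (x - s) - g x‖) (𝓝 0) (𝓝 0) := by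
  have hmp : ∀ s : ℝ, MeasurePreserving (fun x : ℝ => x - s) volume volume := fun s =>
    measurePreserving_sub_right volume s
  have hc : Continuous fun s : ℝ => Lp.compMeasurePreserving (fun x : ℝ => x - s) (hmp s)
      (hg.toL1 g) := by
    have : Continuous fun s : ℝ => (⟨fun x => x - s, by fun_prop⟩ : C(ℝ, ℝ)) :=
      ContinuousMap.continuous_of_continuous_uncurry _
        (show Continuous fun p : ℝ × ℝ => p.2 - p.1 by fun_prop)
    exact (continuous_const (y := hg.toL1 g)).compMeasurePreservingLp this hmp (by simp)
  have h1 := (hc.sub (continuous_const (y := hg.toL1 g))).norm.tendsto 0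
  have h2 : ∀ s : ℝ, ‖Lp.compMeasurePreserving (fun x : ℝ => x - s) (hmp s) (hg.toL1 g) -
      hg.toL1 g‖ = ∫ x, ‖g (x - s) - g x‖ := by
    intro s
    rw [L1.norm_eq_integral_norm]
    refine integral_congr_ae ?_
    filter_upwards [Lp.coeFn_sub (Lp.compMeasurePreserving (fun x : ℝ => x - s) (hmp s)
      (hg.toL1 g)) (hg.toL1 g), Lp.coeFn_compMeasurePreserving (hg.toL1 g) (hmp s),
      hg.coeFn_toL1, ae_comp_sub hg.coeFn_toL1 s] with x h1 h2 h3 h4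
    rw [h1, Pi.sub_apply, h2, h3, Function.comp_apply, h4]
  convert h1.congr h2 using 2
  exact Eq.trans (by simp) (h2 0).symm

/-- Where `g` or its translate is nonzero, the weight is at most `|K| * C`, with `C` a bound for `ω`
near the origin. The weighted norm is thus controlled by the unweighted one, for which translation
is continuous. -/
theorem tendsto_translate_sub_of_bounded (g : BeurlingL1 ω 𝒜) {K : ℝ}
    (hg : ∀ᵐ x, g.1 x ≠ 0 → ω x ≤ K) :
    Tendsto (fun s => ‖translate s g - g‖) (𝓝 0) (𝓝 0) := by
  obtain ⟨C, hC⟩ := ω.exists_forall_nhds_zero_le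
  have hC1 : 1 ≤ C := (ω.one_le' 0).trans hC.self_of_nhds
  have h0 := (tendsto_integral_norm_sub_translate g.integrable).const_mul (|K| * C)
  rw [mul_zero] at h0
  refine squeeze_zero' (.of_forall fun _ => norm_nonneg _) ?_ h0
  filter_upwards [hC] with s hs
  rw [← integral_const_mul]
  refine norm_le_of_ae_le (((g.integrable.comp_sub_right s).sub g.integrable).norm.const_mul _) ?_
  filter_upwards [coeFn_sub (translate s g) g, coeFn_translate s g, hg, ae_comp_sub hg s]
    with x h1 h2 h3 h4
  rw [h1, h2, mul_comm]
  by_cases hx : g.1 x = 0 ∧ g.1 (x - s) = 0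
  · simp [hx]
  · refine mul_le_mul_of_nonneg_right ?_ (norm_nonneg _)
    by_cases hx' : g.1 x = 0
    · have h5 : ω x ≤ ω (x - s) * ω s := by simpa using ω.map_add_le_mul' (x - s) s
      refine h5.trans (mul_le_mul ((h4 fun h => hx ⟨hx', h⟩).trans (le_abs_self K)) hs
        (ω.pos s).le (abs_nonneg _))
    · exact ((h3 hx').trans (le_abs_self K)).trans (le_mul_of_one_le_right (abs_nonneg _) hC1)

theorem tendsto_translate_sub (g : BeurlingL1 ω 𝒜) :
    Tendsto (fun s => ‖translate s g - g‖) (𝓝 0) (𝓝 0) := by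
  obtain ⟨C, hC⟩ := ω.exists_forall_nhds_zero_le
  have hC1 : 1 ≤ C := (ω.one_le' 0).trans hC.self_of_nhds
  refine (tendsto_order.2 ⟨fun a ha => .of_forall fun s => ha.trans_le (norm_nonneg _),
    fun ε hε => ?_⟩)
  -- For small `s` the operator `translate s - 1` has norm at most `C + 1`, so this tail contributes
  -- less than `ε / 2`; the remainder lives where the weight is at most `n`.
  obtain ⟨n, hn⟩ := ((tendsto_norm_tail g).eventually
    (gt_mem_nhds (show 0 < ε / (2 * (C + 1)) by positivity))).exists
  have hb := tendsto_translate_sub_of_bounded (g - tail n g) (K := n) (by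
    filter_upwards [coeFn_sub g (tail n g), coeFn_tail n g] with x h1 h2 h3
    by_contra! h4
    rw [h1, h2, Set.indicator_of_mem (by exact h4), sub_self] at h3
    exact h3 rfl)
  filter_upwards [hC, hb.eventually (gt_mem_nhds (half_pos hε))] with s hs hs'
  have h1 : translate s g - g = (translate s (g - tail n g) - (g - tail n g)) +
      (translate s (tail n g) - tail n g) := by
    rw [map_sub]
    abel
  have h2 : ‖translate s (tail n g) - tail n g‖ ≤ (C + 1) * ‖tail n g‖ := by
    refine (norm_sub_le _ _).trans ?_
    rw [add_mul, one_mul]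
    gcongr
    exact (norm_translate_le _ _).trans (by gcongr)
  rw [lt_div_iff₀ (by positivity)] at hn
  rw [h1]
  refine (norm_add_le _ _).trans_lt ?_
  linarith

/-- Translations act strongly continuously on `L¹(ℝ, ω, 𝒜)`. -/
theorem continuous_translate (g : BeurlingL1 ω 𝒜) : Continuous fun s => translate s g := by
  rw [continuous_iff_continuousAt]
  intro s
  rw [ContinuousAt, tendsto_iff_norm_sub_tendsto_zero]
  have h1 : Tendsto (fun r => ω s * ‖translate (r - s) g - g‖) (𝓝 s) (𝓝 0) := by
    have h2 : Tendsto (fun r : ℝ => r - s) (𝓝 s) (𝓝 0) :=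
      (continuous_sub_right s).tendsto' _ _ (sub_self s)
    simpa using ((tendsto_translate_sub g).comp h2).const_mul (ω s)
  refine squeeze_zero (fun _ => norm_nonneg _) (fun r => ?_) h1
  have : translate r g - translate s g = translate s (translate (r - s) g - g) := by
    rw [map_sub, translate_translate, add_sub_cancel]
  rw [this]
  exact norm_translate_le _ _

/-! ### Convolution as a vector-valued integral of translates -/

theorem integrable_leftMul_translate (f g : BeurlingL1 ω 𝒜) :
    Integrable (fun s => leftMul (f.1 s) (translate s g)) volume := by
  refine (f.integrable_norm_mul.mul_const ‖g‖).mono' ?_ (.of_forall fun s => ?_)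
  · exact (leftMul (ω := ω) (𝒜 := 𝒜)).aestronglyMeasurable_comp₂ f.1.aestronglyMeasurable
      (continuous_translate g).aestronglyMeasurable
  · refine (norm_leftMul_le _ _).trans ?_
    rw [mul_assoc]
    gcongr
    exact norm_translate_le _ _

variable (ω 𝒜) in
/-- Integration over a set, as a continuous linear map on `L¹(ℝ, ω, 𝒜)`. -/
noncomputable def setIntegralCLM (S : Set ℝ) : BeurlingL1 ω 𝒜 →L[ℂ] 𝒜 :=
  LinearMap.mkContinuous
    { toFun := fun f => ∫ x in S, f.1 x
      map_add' := fun f g => by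
        rw [← integral_add f.integrable.integrableOn g.integrable.integrableOn]
        exact integral_congr_ae (ae_restrict_of_ae (coeFn_add f g))
      map_smul' := fun c f => by
        rw [RingHom.id_apply, ← integral_smul]
        exact integral_congr_ae (ae_restrict_of_ae (coeFn_smul c f)) }
    1 fun f => by
      rw [one_mul]
      refine (norm_integral_le_integral_norm _).trans (le_trans ?_ f.integral_norm_le)
      exact setIntegral_le_integral f.integrable.norm (.of_forall fun _ => norm_nonneg _)

theorem setIntegralCLM_apply (S : Set ℝ) (f : BeurlingL1 ω 𝒜) :
    setIntegralCLM ω 𝒜 S f = ∫ x in S, f.1 x := rfl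

variable [CompleteSpace 𝒜]

/-- Both sides have the same integral over every measurable set, by Fubini. This form transfers
properties of single translates to convolution: the norm estimate, the commutation rules, and the
action modulo a closed left ideal. -/
theorem mul_eq_integral (f g : BeurlingL1 ω 𝒜) :
    f * g = ∫ s, leftMul (f.1 s) (translate s g) := by
  refine ext_ae (Integrable.ae_eq_of_forall_setIntegral_eq _ _ (integrable _) (integrable _)
    fun S hS _ => ?_)
  rw [← setIntegralCLM_apply S (∫ s, _),
    ← ContinuousLinearMap.integral_comp_comm _ (integrable_leftMul_translate f g),
    integral_congr_ae (ae_restrict_of_ae (coeFn_mul f g))]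
  have h1 : ∀ s, setIntegralCLM ω 𝒜 S (leftMul (f.1 s) (translate s g)) =
      ∫ x in S, f.1 s * g.1 (x - s) := by
    intro s
    rw [setIntegralCLM_apply]
    refine integral_congr_ae (ae_restrict_of_ae ?_)
    filter_upwards [coeFn_leftMul (f.1 s) (translate s g), coeFn_translate s g] with x h1 h2
    rw [h1, h2]
  simp_rw [h1]
  change ∫ x in S, (∫ t, f.1 t * g.1 (x - t)) = _
  refine integral_integral_swap ?_
  have h2 := f.integrable.convolution_integrand (ContinuousLinearMap.mul ℂ 𝒜) g.integrable
  have h3 := h2.restrict (s := S ×ˢ Set.univ)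
  rw [← Measure.prod_restrict, Measure.restrict_univ] at h3
  exact h3

theorem norm_mul_le' (f g : BeurlingL1 ω 𝒜) : ‖f * g‖ ≤ ‖f‖ * ‖g‖ := by
  rw [mul_eq_integral, norm_def f, ← integral_mul_const]
  refine norm_integral_le_of_norm_le (f.integrable_norm_mul.mul_const _) (.of_forall fun s => ?_)
  refine (norm_leftMul_le _ _).trans ?_
  rw [mul_assoc]
  gcongr
  exact norm_translate_le _ _

theorem leftMul_mul (a : 𝒜) (f g : BeurlingL1 ω 𝒜) : leftMul a (f * g) = leftMul a f * g := by
  rw [mul_eq_integral, mul_eq_integral,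
    ← ContinuousLinearMap.integral_comp_comm _ (integrable_leftMul_translate f g)]
  refine integral_congr_ae ?_
  filter_upwards [coeFn_leftMul a f] with s hs
  rw [hs, leftMul_leftMul]

theorem translate_mul (r : ℝ) (f g : BeurlingL1 ω 𝒜) :
    translate r (f * g) = translate r f * g := by
  rw [mul_eq_integral, mul_eq_integral,
    ← ContinuousLinearMap.integral_comp_comm _ (integrable_leftMul_translate f g),
    ← integral_sub_right_eq_self _ r]
  refine integral_congr_ae ?_
  filter_upwards [coeFn_translate r f] with s hs
  rw [hs, ← leftMul_translate, translate_translate, add_sub_cancel]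

theorem mul_translate (r : ℝ) (f g : BeurlingL1 ω 𝒜) :
    f * translate r g = translate r (f * g) := by
  rw [mul_eq_integral, mul_eq_integral,
    ← ContinuousLinearMap.integral_comp_comm _ (integrable_leftMul_translate f g)]
  refine integral_congr_ae (.of_forall fun s => ?_)
  simp only
  rw [← leftMul_translate, translate_translate, translate_translate, add_comm]

/-- Left multiplication for the convolution product, as a continuous linear map. -/
noncomputable def mulLeftCLM (f : BeurlingL1 ω 𝒜) : BeurlingL1 ω 𝒜 →L[ℂ] BeurlingL1 ω 𝒜 :=
  LinearMap.mkContinuous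
    { toFun := fun g => f * g
      map_add' := mul_add f
      map_smul' := fun c g => mul_smul_comm c f g } ‖f‖ (norm_mul_le' f)

/-- Right multiplication for the convolution product, as a continuous linear map. -/
noncomputable def mulRightCLM (f : BeurlingL1 ω 𝒜) : BeurlingL1 ω 𝒜 →L[ℂ] BeurlingL1 ω 𝒜 :=
  LinearMap.mkContinuous
    { toFun := fun g => g * f
      map_add' := fun g h => add_mul g h f
      map_smul' := fun c g => smul_mul_assoc c g f } ‖f‖
    (fun g => (norm_mul_le' g f).trans_eq (mul_comm _ _))

theorem norm_mulRightCLM_le (f : BeurlingL1 ω 𝒜) : ‖mulRightCLM f‖ ≤ ‖f‖ :=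
  LinearMap.mkContinuous_norm_le _ (norm_nonneg _) _

end BeurlingL1

namespace BeurlingL1

variable {ω : BeurlingWeight} {𝒜 : Type*} [NormedRing 𝒜] [NormedAlgebra ℂ 𝒜]

/-! ### Fourier transform -/

theorem integrable_fourier (f : BeurlingL1 ω 𝒜) (t : ℝ) :
    Integrable (fun x : ℝ => Complex.exp (Complex.I * t * x) • f.1 x) volume := by
  refine f.integrable.norm.mono' ?_ (.of_forall fun x => ?_)
  · exact (by fun_prop : Continuous fun x : ℝ =>
      Complex.exp (Complex.I * t * x)).aestronglyMeasurable.smul f.1.aestronglyMeasurable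
  · rw [norm_smul, Complex.norm_exp]
    simp

theorem fourier_neg (f : BeurlingL1 ω 𝒜) (t : ℝ) : (-f).fourier t = -f.fourier t := by
  rw [fourier, fourier, ← integral_neg]
  refine integral_congr_ae ?_
  filter_upwards [coeFn_neg f] with x hx
  rw [hx, smul_neg]

/-! ### Passage to the opposite algebra -/

open MulOpposite

/-- The image of `f` in the opposite algebra. -/
noncomputable def opMap (f : BeurlingL1 ω 𝒜) : BeurlingL1 ω 𝒜ᵐᵒᵖ :=
  ofFun (fun x => op (f.1 x)) (continuous_op.comp_aestronglyMeasurable f.1.aestronglyMeasurable)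
    f.integrable_norm_mul

/-- The image of `f` in the original algebra. -/
noncomputable def unopMap (f : BeurlingL1 ω 𝒜ᵐᵒᵖ) : BeurlingL1 ω 𝒜 :=
  ofFun (fun x => unop (f.1 x)) (continuous_unop.comp_aestronglyMeasurable f.1.aestronglyMeasurable)
    f.integrable_norm_mul

theorem coeFn_opMap (f : BeurlingL1 ω 𝒜) :
    ((opMap f).1 : ℝ → 𝒜ᵐᵒᵖ) =ᵐ[volume] fun x => op (f.1 x) :=
  coeFn_ofFun _ _ _

theorem coeFn_unopMap (f : BeurlingL1 ω 𝒜ᵐᵒᵖ) :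
    ((unopMap f).1 : ℝ → 𝒜) =ᵐ[volume] fun x => unop (f.1 x) :=
  coeFn_ofFun _ _ _

theorem fourier_opMap (f : BeurlingL1 ω 𝒜) (t : ℝ) : (opMap f).fourier t = op (f.fourier t) := by
  rw [fourier, fourier]
  change _ = (opContinuousLinearEquiv ℂ : 𝒜 ≃L[ℂ] 𝒜ᵐᵒᵖ) _
  rw [← ContinuousLinearEquiv.integral_comp_comm]
  refine integral_congr_ae ?_
  filter_upwards [coeFn_opMap f] with x hx
  rw [hx]
  rfl

theorem unopMap_opMap (f : BeurlingL1 ω 𝒜) : unopMap (opMap f) = f := by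
  refine ext_ae ?_
  filter_upwards [coeFn_unopMap (opMap f), coeFn_opMap f] with x h1 h2
  rw [h1, h2, unop_op]

theorem unopMap_add (f g : BeurlingL1 ω 𝒜ᵐᵒᵖ) : unopMap (f + g) = unopMap f + unopMap g := by
  refine ext_ae ?_
  filter_upwards [coeFn_unopMap (f + g), coeFn_unopMap f, coeFn_unopMap g, coeFn_add f g,
    coeFn_add (unopMap f) (unopMap g)] with x h1 h2 h3 h4 h5
  rw [h1, h4, h5, h2, h3, unop_add]

theorem unopMap_neg (f : BeurlingL1 ω 𝒜ᵐᵒᵖ) : unopMap (-f) = -unopMap f := by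
  refine ext_ae ?_
  filter_upwards [coeFn_unopMap (-f), coeFn_unopMap f, coeFn_neg f,
    coeFn_neg (unopMap f)] with x h1 h2 h3 h4
  rw [h1, h3, h4, h2, unop_neg]

/-- Reversing the factors in `∫ f (x - t) * g t` gives the other standard form of convolution, with
the roles of `f` and `g` exchanged. -/
theorem unopMap_mul (f g : BeurlingL1 ω 𝒜ᵐᵒᵖ) : unopMap (f * g) = unopMap g * unopMap f := by
  refine ext_ae ?_
  filter_upwards [coeFn_unopMap (f * g), coeFn_mul f g, coeFn_mul (unopMap g) (unopMap f)]
    with x h1 h2 h3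
  rw [h1, h2, h3, conv_apply]
  change (opContinuousLinearEquiv ℂ : 𝒜 ≃L[ℂ] 𝒜ᵐᵒᵖ).symm _ = _
  rw [← ContinuousLinearEquiv.integral_comp_comm, conv,
    convolution_congr _ (coeFn_unopMap g) (coeFn_unopMap f)]
  rfl

/-! ### Wiener's lemma -/

variable [CompleteSpace 𝒜]

variable (ω 𝒜) in
/-- The operators whose common invariant subspaces are the left ideals of `L¹(ℝ, ω, 𝒜)` that are
stable under translations and under left multiplication by `𝒜`. -/
def leftOperators : Set (BeurlingL1 ω 𝒜 →L[ℂ] BeurlingL1 ω 𝒜) :=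
  Set.range (fun a : 𝒜 => leftMul a) ∪ Set.range translate ∪ Set.range mulLeftCLM

theorem leftMul_mem_leftOperators (a : 𝒜) : leftMul a ∈ leftOperators ω 𝒜 :=
  .inl (.inl ⟨a, rfl⟩)

theorem translate_mem_leftOperators (s : ℝ) : translate s ∈ leftOperators ω 𝒜 :=
  .inl (.inr ⟨s, rfl⟩)

theorem mulLeftCLM_mem_leftOperators (f : BeurlingL1 ω 𝒜) : mulLeftCLM f ∈ leftOperators ω 𝒜 :=
  .inr ⟨f, rfl⟩

theorem map_mul_of_mem_leftOperators {S : BeurlingL1 ω 𝒜 →L[ℂ] BeurlingL1 ω 𝒜}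
    (hS : S ∈ leftOperators ω 𝒜) (f g : BeurlingL1 ω 𝒜) : S (f * g) = S f * g := by
  rcases hS with (⟨a, rfl⟩ | ⟨s, rfl⟩) | ⟨h, rfl⟩
  · exact leftMul_mul a f g
  · exact translate_mul s f g
  · exact (mul_assoc h f g).symm

/-- Commutativity of `(ℝ, +)` is what makes translations central here, even for noncommutative `𝒜`;
Schur's lemma then applies to them. -/
theorem comm_translate_of_mem_leftOperators {S : BeurlingL1 ω 𝒜 →L[ℂ] BeurlingL1 ω 𝒜}
    (hS : S ∈ leftOperators ω 𝒜) (s : ℝ) (f : BeurlingL1 ω 𝒜) :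
    S (translate s f) = translate s (S f) := by
  rcases hS with (⟨a, rfl⟩ | ⟨r, rfl⟩) | ⟨h, rfl⟩
  · exact leftMul_translate a s f
  · rw [translate_translate, translate_translate, add_comm]
  · exact mul_translate s h f

/-- If translations act on `u` by scalars `χ s` modulo a closed left ideal `M`, then `g * u` is
congruent to `(∫ χ(s) g(s) ds) u`. -/
theorem mul_sub_leftMul_integral_mem {M : Submodule ℂ (BeurlingL1 ω 𝒜)}
    (hM : M.IsInvariant (leftOperators ω 𝒜)) (hcl : IsClosed (M : Set (BeurlingL1 ω 𝒜)))
    {u : BeurlingL1 ω 𝒜} {χ : ℝ → ℂ} (hχ : ∀ s, translate s u - χ s • u ∈ M)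
    (g : BeurlingL1 ω 𝒜) (hint : Integrable (fun s => χ s • g.1 s) volume) :
    g * u - leftMul (∫ s, χ s • g.1 s) u ∈ M := by
  have h1 : leftMul (∫ s, χ s • g.1 s) u = ∫ s, leftMul (χ s • g.1 s) u :=
    (((leftMul (ω := ω) (𝒜 := 𝒜)).flip u).integral_comp_comm hint).symm
  have hint' : Integrable (fun s => leftMul (χ s • g.1 s) u) volume :=
    ((leftMul (ω := ω) (𝒜 := 𝒜)).flip u).integrable_comp hint
  rw [h1, mul_eq_integral, ← integral_sub (integrable_leftMul_translate g u) hint']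
  have : IsClosed (M : Set (BeurlingL1 ω 𝒜)) := hcl
  rw [← Submodule.Quotient.mk_eq_zero M]
  change M.mkQL _ = 0
  have hsub : Integrable (fun s => leftMul (g.1 s) (translate s u) - leftMul (χ s • g.1 s) u)
      volume := (integrable_leftMul_translate g u).sub hint'
  rw [← ContinuousLinearMap.integral_comp_comm _ hsub]
  refine integral_eq_zero_of_ae (.of_forall fun s => ?_)
  refine (Submodule.Quotient.mk_eq_zero M).2 ?_
  have h2 := hM _ (leftMul_mem_leftOperators (g.1 s)) _ (hχ s)
  rwa [map_sub, map_smul, ← smul_apply, ← map_smul] at h2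

/-- The scalars by which translations act modulo a closed subspace form a unitary character,
provided that the weight is admissible. -/
theorem exists_eq_cexp_of_translate (hω : ω.IsAdmissible) {M : Submodule ℂ (BeurlingL1 ω 𝒜)}
    (hcl : IsClosed (M : Set (BeurlingL1 ω 𝒜))) {u : BeurlingL1 ω 𝒜} (hu : u ∉ M) {χ : ℝ → ℂ}
    (hχ : ∀ s x, translate s x - χ s • x ∈ M) :
    ∃ t : ℝ, ∀ s : ℝ, χ s = Complex.exp (Complex.I * t * s) := by
  have : IsClosed (M : Set (BeurlingL1 ω 𝒜)) := hcl
  have hmk : ∀ s x, M.mkQL (translate s x) = χ s • M.mkQL x := fun s x => by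
    rw [← map_smul]
    exact (Submodule.Quotient.eq M).2 (hχ s x)
  have hu0 : M.mkQL u ≠ 0 := fun h => hu ((Submodule.Quotient.mk_eq_zero M).1 h)
  -- A functional normalized at the class of `u` expresses `χ` as a matrix coefficient of
  -- translations, which yields both its continuity and its bound by a multiple of the weight.
  obtain ⟨φ, hφ⟩ := SeparatingDual.exists_eq_one (R := ℂ) hu0
  have hχφ : ∀ s, χ s = φ (M.mkQL (translate s u)) := fun s => by
    rw [hmk, map_smul, hφ, smul_eq_mul, mul_one]
  have hc : Continuous χ := by
    rw [funext hχφ]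
    exact φ.continuous.comp (M.mkQL.continuous.comp (continuous_translate u))
  have h0 : χ 0 = 1 := by rw [hχφ, translate_zero, hφ]
  have hadd : ∀ s r, χ (s + r) = χ s * χ r := fun s r => by
    rw [hχφ (s + r), ← translate_translate, hmk, hmk, smul_smul, map_smul, hφ, smul_eq_mul, mul_one]
  obtain ⟨z, hz⟩ := exists_eq_cexp_of_continuous hc h0 hadd
  have hre : z.re = 0 := hω.re_eq_zero (C := ‖φ.comp M.mkQL‖ * ‖u‖) fun x => by
    rw [← hz, hχφ]
    refine ((φ.comp M.mkQL).le_opNorm _).trans ?_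
    rw [mul_assoc, mul_comm ‖u‖]
    gcongr
    exact norm_translate_le _ _
  refine ⟨z.im, fun s => ?_⟩
  rw [hz]
  congr 2
  apply Complex.ext <;> simp [hre]

/-- Wiener's lemma for admissible weights: if `1 + f̂(t)` is left invertible for every real `t`,
then `-f` has the form `g + g * f`. -/
theorem exists_add_mul_eq_neg (hω : ω.IsAdmissible) (f : BeurlingL1 ω 𝒜)
    (hf : ∀ t : ℝ, ∃ b : 𝒜, b * (1 + f.fourier t) = 1) :
    ∃ g : BeurlingL1 ω 𝒜, g + g * f = -f := by
  let J : Submodule ℂ (BeurlingL1 ω 𝒜) :=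
    LinearMap.range ((1 : BeurlingL1 ω 𝒜 →L[ℂ] BeurlingL1 ω 𝒜) + mulRightCLM f).toLinearMap
  have hJmem : ∀ g : BeurlingL1 ω 𝒜, g + g * f ∈ J := fun g => ⟨g, rfl⟩
  by_contra hno
  have hu : -f ∉ J := fun ⟨g, hg⟩ => hno ⟨g, hg⟩
  have hJ : J.IsInvariant (leftOperators ω 𝒜) := by
    rintro S hS _ ⟨g, rfl⟩
    refine ⟨S g, ?_⟩
    change S g + S g * f = S (g + g * f)
    rw [map_add, map_mul_of_mem_leftOperators hS]
  -- This says that `-f` is a right unit modulo every subspace containing `J`.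
  have hmodular : ∀ N : Submodule ℂ (BeurlingL1 ω 𝒜), J ≤ N → ∀ g, g - g * (-f) ∈ N :=
    fun N hN g => by
      rw [mul_neg, sub_neg_eq_add]
      exact hN (hJmem g)
  have htop : ∀ N : Submodule ℂ (BeurlingL1 ω 𝒜), N.IsInvariant (leftOperators ω 𝒜) → J ≤ N →
      -f ∈ N → N = ⊤ := fun N hN hJN hfN => by
    refine Submodule.eq_top_iff'.2 fun g => ?_
    have h := N.add_mem (hmodular N hJN g) (hN _ (mulLeftCLM_mem_leftOperators g) _ hfN)
    rwa [show mulLeftCLM g (-f) = g * (-f) from rfl, sub_add_cancel] at h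
  have hclosure : ∀ N : Submodule ℂ (BeurlingL1 ω 𝒜), N.IsInvariant (leftOperators ω 𝒜) → J ≤ N →
      -f ∈ N.topologicalClosure → -f ∈ N := by
    intro N hN hJN hfN
    -- Within distance `1` of `-f`, a Neumann series solves `h - h * (-f - m) = -f`. The left side
    -- equals `(h - h * (-f)) + h * m`, and both summands lie in `N`.
    obtain ⟨m, hm, hlt⟩ := Metric.mem_closure_iff.1 hfN 1 one_pos
    rw [dist_eq_norm] at hlt
    have hunit := ContinuousLinearMap.isUnit_iff_bijective.1
      (isUnit_one_sub_of_norm_lt_one ((norm_mulRightCLM_le (-f - m)).trans_lt hlt))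
    obtain ⟨h, hh⟩ := hunit.2 (-f)
    rw [← hh]
    change h - h * (-f - m) ∈ N
    rw [mul_sub, ← sub_add]
    exact N.add_mem (hmodular N hJN h) (hN _ (mulLeftCLM_mem_leftOperators h) _ hm)
  obtain ⟨M, hM, hJM, huM, hcl, hmax⟩ := exists_maximal_isInvariant hJ hu hclosure
  have hscalar : ∀ s : ℝ, ∃ c : ℂ, ∀ x : BeurlingL1 ω 𝒜, translate s x - c • x ∈ M := fun s =>
    exists_sub_smul_mem_of_maximal hM huM hcl hmax
      (fun N hN hMN huN => htop N hN (hJM.trans hMN) huN) (translate_mem_leftOperators s)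
      fun S hS x => comm_translate_of_mem_leftOperators hS s x
  choose χ hχ using hscalar
  obtain ⟨t, ht⟩ := exists_eq_cexp_of_translate hω hcl huM hχ
  have hint := integrable_fourier (-f) t
  simp_rw [← ht] at hint
  have h1 := mul_sub_leftMul_integral_mem hM hcl (fun s => hχ s (-f)) (-f) hint
  have h2 : ∫ s, χ s • (-f).1 s = -f.fourier t := by
    rw [← fourier_neg, fourier]
    simp_rw [ht]
  -- The product `(-f) * (-f)` cancels between the modular relation and the relation for the Fourier
  -- transform.
  have h3 := M.add_mem (hmodular M hJM (-f)) h1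
  rw [h2, sub_add_sub_cancel] at h3
  have h4 : -f - leftMul (-f.fourier t) (-f) = leftMul (1 + f.fourier t) (-f) := by
    rw [map_add, add_apply, leftMul_one, map_neg (leftMul (ω := ω) (𝒜 := 𝒜)) (f.fourier t),
      neg_apply, sub_neg_eq_add]
  obtain ⟨b, hb⟩ := hf t
  have h5 := hM _ (leftMul_mem_leftOperators b) _ h3
  rw [h4, leftMul_leftMul, hb, leftMul_one] at h5
  exact huM h5

theorem oneAdd_mul_oneAdd (g f : BeurlingL1 ω 𝒜) :
    g.oneAdd * f.oneAdd = 1 + Unitization.inr (f + (g + g * f)) := by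
  simp only [oneAdd, mul_add, add_mul, one_mul, mul_one, Unitization.inr_add, Unitization.inr_mul]
  abel

theorem exists_oneAdd_mul_oneAdd_eq_one (hω : ω.IsAdmissible) (f : BeurlingL1 ω 𝒜)
    (hf : ∀ t : ℝ, ∃ b : 𝒜, b * (1 + f.fourier t) = 1) :
    ∃ g : BeurlingL1 ω 𝒜, g.oneAdd * f.oneAdd = 1 := by
  obtain ⟨g, hg⟩ := exists_add_mul_eq_neg hω f hf
  exact ⟨g, by rw [oneAdd_mul_oneAdd, hg, add_neg_cancel, Unitization.inr_zero, add_zero]⟩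

/-- Passing to `𝒜ᵐᵒᵖ` reverses convolution products and commutes with the Fourier transform, so
right inverses become left inverses. -/
theorem exists_mul_oneAdd_eq_one (hω : ω.IsAdmissible) (f : BeurlingL1 ω 𝒜)
    (hf : ∀ t : ℝ, ∃ b : 𝒜, (1 + f.fourier t) * b = 1) :
    ∃ g : BeurlingL1 ω 𝒜, f.oneAdd * g.oneAdd = 1 := by
  obtain ⟨g, hg⟩ := exists_add_mul_eq_neg hω (opMap f) fun t => by
    obtain ⟨b, hb⟩ := hf t
    refine ⟨op b, ?_⟩
    rw [fourier_opMap, ← op_one, ← op_add, ← op_mul, hb]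
  refine ⟨unopMap g, ?_⟩
  have h := congrArg unopMap hg
  rw [unopMap_add, unopMap_mul, unopMap_neg, unopMap_opMap] at h
  rw [oneAdd_mul_oneAdd, add_left_comm, h, add_neg_cancel, Unitization.inr_zero, add_zero]

end BeurlingL1

/-! ### The three cases assembled -/

theorem theorem1p3 {𝒜 : Type*} [NormedRing 𝒜] [NormedAlgebra ℂ 𝒜] [CompleteSpace 𝒜]
    (ω : BeurlingWeight) (f : BeurlingL1 ω 𝒜) :
    -- the left invertible case
    ((∀ t : ℝ, ∃ b : 𝒜, b * (1 + f.fourier t) = 1) →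
      (∃ (ν : BeurlingWeight) (hν : ∀ x, ν x ≤ ω x) (g : BeurlingL1 ν 𝒜),
        (∀ x, 1 ≤ ν x) ∧ (ν.IsConstant ↔ ω.IsConstant) ∧
        g.oneAdd * (BeurlingL1.incl hν f).oneAdd = 1) ∧
      (ω.IsAdmissible → ∃ u : Unitization ℂ (BeurlingL1 ω 𝒜), u * f.oneAdd = 1)) ∧
    -- the right invertible case
    ((∀ t : ℝ, ∃ b : 𝒜, (1 + f.fourier t) * b = 1) →
      (∃ (ν : BeurlingWeight) (hν : ∀ x, ν x ≤ ω x) (g : BeurlingL1 ν 𝒜),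
        (∀ x, 1 ≤ ν x) ∧ (ν.IsConstant ↔ ω.IsConstant) ∧
        (BeurlingL1.incl hν f).oneAdd * g.oneAdd = 1) ∧
      (ω.IsAdmissible → ∃ u : Unitization ℂ (BeurlingL1 ω 𝒜), f.oneAdd * u = 1)) ∧
    -- the (two-sided) invertible case
    ((∀ t : ℝ, IsUnit (1 + f.fourier t)) →
      (∃ (ν : BeurlingWeight) (hν : ∀ x, ν x ≤ ω x) (g : BeurlingL1 ν 𝒜),
        (∀ x, 1 ≤ ν x) ∧ (ν.IsConstant ↔ ω.IsConstant) ∧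
        g.oneAdd * (BeurlingL1.incl hν f).oneAdd = 1 ∧
        (BeurlingL1.incl hν f).oneAdd * g.oneAdd = 1) ∧
      (ω.IsAdmissible → IsUnit f.oneAdd)) := by
  obtain ⟨ν, hν, hadm, hconst⟩ := ω.exists_isAdmissible_le
  have two_sided : ∀ {μ : BeurlingWeight}, μ.IsAdmissible → ∀ h : BeurlingL1 μ 𝒜,
      (∀ t : ℝ, IsUnit (1 + h.fourier t)) →
      ∃ g : BeurlingL1 μ 𝒜, g.oneAdd * h.oneAdd = 1 ∧ h.oneAdd * g.oneAdd = 1 := by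
    intro μ hμ h hh
    obtain ⟨g, hg⟩ := BeurlingL1.exists_oneAdd_mul_oneAdd_eq_one hμ h
      fun t => (hh t).exists_left_inv
    obtain ⟨g', hg'⟩ := BeurlingL1.exists_mul_oneAdd_eq_one hμ h fun t => (hh t).exists_right_inv
    exact ⟨g, hg, left_inv_eq_right_inv hg hg' ▸ hg'⟩
  refine ⟨fun h => ⟨?_, fun hω => ?_⟩, fun h => ⟨?_, fun hω => ?_⟩, fun h => ⟨?_, fun hω => ?_⟩⟩
  -- Inclusion keeps the underlying class, so the Fourier transform is unchanged definitionally and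
  -- `h` applies as it stands.
  · obtain ⟨g, hg⟩ := BeurlingL1.exists_oneAdd_mul_oneAdd_eq_one hadm (BeurlingL1.incl hν f) h
    exact ⟨ν, hν, g, ν.one_le', hconst, hg⟩
  · obtain ⟨g, hg⟩ := BeurlingL1.exists_oneAdd_mul_oneAdd_eq_one hω f h
    exact ⟨_, hg⟩
  · obtain ⟨g, hg⟩ := BeurlingL1.exists_mul_oneAdd_eq_one hadm (BeurlingL1.incl hν f) h
    exact ⟨ν, hν, g, ν.one_le', hconst, hg⟩
  · obtain ⟨g, hg⟩ := BeurlingL1.exists_mul_oneAdd_eq_one hω f h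
    exact ⟨_, hg⟩
  · obtain ⟨g, hg, hg'⟩ := two_sided hadm (BeurlingL1.incl hν f) h
    exact ⟨ν, hν, g, ν.one_le', hconst, hg, hg'⟩
  · obtain ⟨g, hg, hg'⟩ := two_sided hω f h
    exact ⟨⟨_, _, hg', hg⟩, rfl⟩
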